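/- For positive integers $s_1,\dots,s_k$ ($k\ge 1$) let $$\delta_{s_1,\dots,s_k}:=\mathrm{Li}_{s_1,\dots,s_k}\left(\tfrac12\right)=\sum_{n_1>n_2>\cdots>n_k\ge 1}\frac{2^{-n_1}}{n_1^{s_1}\cdots n_k^{s_k}},$$ and, if moreover $s_1\ge 2$, let $$\zeta_{s_1,\dots,s_k}:=\sum_{n_1>n_2>\cdots>n_k\ge 1}\frac{1}{n_1^{s_1}\cdots n_k^{s_k}}.$$ The series defining $\zeta_{4,1}$, $\delta_{4,1}$, $\delta_{3,1}$, $\delta_{2,1}$, $\delta_{3,1,1}$ and $\delta_{2,1,1}$ converge, and $$\zeta_{4,1}=\delta_{4,1}+\delta_{3,1}\ln 2+\tfrac12\,\delta_{2,1}(\ln 2)^2+\delta_{3,1,1}+\delta_{2,1,1}\ln 2+\tfrac1{12}(\ln 2)^5.$$ -/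

import Mathlib

noncomputable section

/-- The summation range `n₁ > n₂ > ⋯ > n_k ≥ 1` (0-indexed: `n 0 > n 1 > ⋯ > n (k-1) ≥ 1`). -/
def DecreasingIndex (k : ℕ) : Type :=
  {n : Fin k → ℕ // StrictAnti n ∧ ∀ i, 1 ≤ n i}

/-- The general term `1 / (n₁ ^ s₁ ⋯ n_k ^ s_k)` of the multiple zeta series. -/
def multiZetaTerm {k : ℕ} (s : Fin k → ℕ) (n : DecreasingIndex k) : ℝ :=
  1 / ∏ i, (n.1 i : ℝ) ^ s i

/-- The multiple zeta value `ζ_{s₁,…,s_k}`, the sum over `n₁ > ⋯ > n_k ≥ 1` of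
`1 / (n₁ ^ s₁ ⋯ n_k ^ s_k)`. -/
def multiZeta {k : ℕ} (s : Fin k → ℕ) : ℝ :=
  ∑' n : DecreasingIndex k, multiZetaTerm s n

/-- The general term `z₁ ^ n₁ ⋯ z_k ^ n_k / (n₁ ^ s₁ ⋯ n_k ^ s_k)` of the multiple polylogarithm
series. -/
def multiPolylogTerm {k : ℕ} (s : Fin k → ℕ) (z : Fin k → ℝ) (n : DecreasingIndex k) : ℝ :=
  (∏ i, z i ^ n.1 i) / ∏ i, (n.1 i : ℝ) ^ s i

/-- The multiple polylogarithm `Li_{s₁,…,s_k}(z₁,…,z_k)`. -/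
def multiPolylog {k : ℕ} (s : Fin k → ℕ) (z : Fin k → ℝ) : ℝ :=
  ∑' n : DecreasingIndex k, multiPolylogTerm s z n

/-- The argument vector `(z, 1, …, 1)` of a single-variable multiple polylogarithm. -/
def singleArg (k : ℕ) (z : ℝ) : Fin (k + 1) → ℝ :=
  Fin.cons z (fun _ => 1)

/-- The single-variable multiple polylogarithm `Li_{s₁,…,s_k}(z) = Li_{s₁,…,s_k}(z, 1, …, 1)`
(the depth, here `k + 1`, is at least one). -/
def singleMultiPolylog {k : ℕ} (s : Fin (k + 1) → ℕ) (z : ℝ) : ℝ :=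
  multiPolylog s (singleArg k z)

/-- The delta value `δ_{s₁,…,s_k} = Li_{s₁,…,s_k}(1/2)`. -/
def deltaValue {k : ℕ} (s : Fin (k + 1) → ℕ) : ℝ :=
  singleMultiPolylog s (1 / 2)

/-- The series that defines the delta value `δ_{s₁,…,s_k}` converges. -/
def DeltaConverges {k : ℕ} (s : Fin (k + 1) → ℕ) : Prop :=
  Summable (multiPolylogTerm s (singleArg k (1 / 2)))

end

open Filter Topology Set

/-- The nested harmonic sums `∑_{n ≥ m₁ > ⋯ > m_k ≥ 1} 1 / (m₁ ⋯ m_k)`. -/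
noncomputable def nestedHarmonic : ℕ → ℕ → ℝ
  | 0, _ => 1
  | k + 1, n => ∑ m ∈ Finset.range n, nestedHarmonic k m / ((m : ℝ) + 1)

/-- The polylogarithm `Li_{s,1,…,1}` with `k` trailing ones, as a power series. -/
noncomputable def onesPolylog (k s : ℕ) (z : ℝ) : ℝ :=
  ∑' n : ℕ, nestedHarmonic k n / ((n : ℝ) + 1) ^ s * z ^ (n + 1)

theorem nestedHarmonic_nonneg (k n : ℕ) : 0 ≤ nestedHarmonic k n := by
  induction k generalizing n with
  | zero => simp [nestedHarmonic]
  | succ k ih =>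
    rw [nestedHarmonic]
    exact Finset.sum_nonneg fun m _ => div_nonneg (ih m) (by positivity)

theorem nestedHarmonic_le (k n : ℕ) : nestedHarmonic k n ≤ ((n : ℝ) + 1) ^ k := by
  induction k generalizing n with
  | zero => simp [nestedHarmonic]
  | succ k ih =>
    rw [nestedHarmonic]
    calc ∑ m ∈ Finset.range n, nestedHarmonic k m / ((m : ℝ) + 1)
        ≤ ∑ m ∈ Finset.range n, ((n : ℝ) + 1) ^ k := by
          refine Finset.sum_le_sum fun m hm => ?_
          have hmn : (m : ℝ) ≤ n := by exact_mod_cast (Finset.mem_range.1 hm).le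
          calc nestedHarmonic k m / ((m : ℝ) + 1) ≤ nestedHarmonic k m :=
                div_le_self (nestedHarmonic_nonneg k m) (by linarith [(Nat.cast_nonneg m : (0 : ℝ) ≤ m)])
            _ ≤ ((m : ℝ) + 1) ^ k := ih m
            _ ≤ ((n : ℝ) + 1) ^ k := by gcongr
      _ = n * ((n : ℝ) + 1) ^ k := by simp
      _ ≤ ((n : ℝ) + 1) ^ (k + 1) := by
          rw [pow_succ']
          gcongr
          linarith

theorem onesPolylog_coeff_nonneg (k s n : ℕ) :
    0 ≤ nestedHarmonic k n / ((n : ℝ) + 1) ^ s :=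
  div_nonneg (nestedHarmonic_nonneg k n) (by positivity)

theorem onesPolylog_coeff_le (k s n : ℕ) :
    nestedHarmonic k n / ((n : ℝ) + 1) ^ s ≤ ((n : ℝ) + 1) ^ k :=
  (div_le_self (nestedHarmonic_nonneg k n)
    (one_le_pow₀ (by linarith [(Nat.cast_nonneg n : (0 : ℝ) ≤ n)]))).trans (nestedHarmonic_le k n)

theorem summable_add_one_pow_mul_geometric (k : ℕ) {r : ℝ} (hr : |r| < 1) :
    Summable fun n : ℕ => ((n : ℝ) + 1) ^ k * r ^ n := by
  rcases eq_or_ne r 0 with rfl | h0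
  · refine summable_of_ne_finset_zero (s := {0}) fun n hn => ?_
    rw [zero_pow (by simpa using hn), mul_zero]
  · have h := (summable_nat_add_iff 1).2
      (summable_pow_mul_geometric_of_norm_lt_one k (r := r) (by simpa using hr))
    refine (h.mul_left r⁻¹).congr fun n => ?_
    push_cast
    field_simp
    ring

theorem summable_of_coeff_le {c : ℕ → ℝ} {k : ℕ} (hc : ∀ n, |c n| ≤ ((n : ℝ) + 1) ^ k)
    {z : ℝ} (hz : |z| < 1) : Summable fun n => c n * z ^ n := by
  refine Summable.of_norm_bounded
    (summable_add_one_pow_mul_geometric k (r := |z|) (by simpa using hz)) fun n => ?_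
  rw [Real.norm_eq_abs, abs_mul, abs_pow]
  gcongr
  exact hc n

theorem hasDerivAt_tsum_mul_pow_succ {c : ℕ → ℝ} {k : ℕ} (hc : ∀ n, |c n| ≤ ((n : ℝ) + 1) ^ k)
    {z : ℝ} (hz : |z| < 1) :
    HasDerivAt (fun z => ∑' n, c n * z ^ (n + 1)) (∑' n : ℕ, c n * ((n : ℝ) + 1) * z ^ n) z := by
  obtain ⟨r, hzr, hr1⟩ := exists_between hz
  have hr0 : 0 ≤ r := (abs_nonneg z).trans hzr.le
  refine hasDerivAt_tsum_of_isPreconnected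
    (summable_add_one_pow_mul_geometric (k + 1) (r := r) (by rwa [abs_of_nonneg hr0]))
    (Metric.isOpen_ball (x := (0 : ℝ)) (ε := r)) (convex_ball _ _).isPreconnected
    (g := fun n z => c n * z ^ (n + 1)) (g' := fun n z => c n * ((n : ℝ) + 1) * z ^ n)
    (fun n y _ => ?_) (fun n y hy => ?_) (y₀ := 0) ?_ ?_ ?_
  · have := (hasDerivAt_pow (n + 1) y).const_mul (c n)
    refine this.congr_deriv ?_
    push_cast
    ring
  · have hy' : |y| ≤ r := by simpa using (Metric.mem_ball.1 hy).le
    rw [Real.norm_eq_abs, abs_mul, abs_mul, abs_pow, pow_succ, abs_of_nonneg (by positivity : (0 : ℝ) ≤ (n : ℝ) + 1)]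
    gcongr
    exact hc n
  · exact Metric.mem_ball_self ((abs_nonneg z).trans_lt hzr)
  · simp
  · simpa using hzr

theorem abs_onesPolylog_coeff_le (k s n : ℕ) :
    |nestedHarmonic k n / ((n : ℝ) + 1) ^ s| ≤ ((n : ℝ) + 1) ^ k := by
  rw [abs_of_nonneg (onesPolylog_coeff_nonneg k s n)]
  exact onesPolylog_coeff_le k s n

theorem summable_onesPolylog (k s : ℕ) {z : ℝ} (hz : |z| < 1) :
    Summable fun n : ℕ => nestedHarmonic k n / ((n : ℝ) + 1) ^ s * z ^ (n + 1) := by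
  refine ((summable_of_coeff_le (abs_onesPolylog_coeff_le k s) hz).mul_right z).congr fun n => ?_
  ring

theorem onesPolylog_zero_right (k s : ℕ) : onesPolylog k s 0 = 0 := by
  simp [onesPolylog]

theorem onesPolylog_nonneg (k s : ℕ) {z : ℝ} (hz : 0 ≤ z) : 0 ≤ onesPolylog k s z :=
  tsum_nonneg fun n => mul_nonneg (onesPolylog_coeff_nonneg k s n) (by positivity)

theorem onesPolylog_le_one_weight (k : ℕ) {s : ℕ} (hs : 1 ≤ s) {z : ℝ} (hz : 0 ≤ z)
    (hz1 : z < 1) : onesPolylog k s z ≤ onesPolylog k 1 z := by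
  have hz' : |z| < 1 := by rwa [abs_of_nonneg hz]
  refine (summable_onesPolylog k s hz').tsum_le_tsum (fun n => ?_) (summable_onesPolylog k 1 hz')
  have := nestedHarmonic_nonneg k n
  gcongr
  linarith [(Nat.cast_nonneg n : (0 : ℝ) ≤ n)]

theorem hasDerivAt_onesPolylog_succ (k s : ℕ) {z : ℝ} (hz0 : z ≠ 0) (hz : |z| < 1) :
    HasDerivAt (onesPolylog k (s + 1)) (onesPolylog k s z / z) z := by
  have h := hasDerivAt_tsum_mul_pow_succ (abs_onesPolylog_coeff_le k (s + 1)) hz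
  refine h.congr_deriv ?_
  rw [onesPolylog, ← tsum_div_const]
  refine tsum_congr fun n => ?_
  field_simp
  ring

theorem hasDerivAt_onesPolylog_one (k : ℕ) {z : ℝ} (hz : |z| < 1) :
    HasDerivAt (onesPolylog k 1) (∑' n : ℕ, nestedHarmonic k n * z ^ n) z := by
  have h := hasDerivAt_tsum_mul_pow_succ (abs_onesPolylog_coeff_le k 1) hz
  refine h.congr_deriv (tsum_congr fun n => ?_)
  field_simp

theorem hasDerivAt_onesPolylog_succ_one (k : ℕ) {z : ℝ} (hz : |z| < 1) :
    HasDerivAt (onesPolylog (k + 1) 1) (onesPolylog k 1 z / (1 - z)) z := by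
  refine (hasDerivAt_onesPolylog_one (k + 1) hz).congr_deriv (Eq.symm ?_)
  have hz1 : (1 : ℝ) - z ≠ 0 := by linarith [(abs_lt.1 hz).2]
  rw [div_eq_iff hz1]
  have hs : Summable fun n : ℕ => nestedHarmonic (k + 1) n * z ^ n :=
    summable_of_coeff_le (k := k + 1)
      (fun n => by rw [abs_of_nonneg (nestedHarmonic_nonneg _ _)]; exact nestedHarmonic_le _ _) hz
  have hs' := (summable_nat_add_iff 1).2 hs
  rw [mul_sub, mul_one, ← tsum_mul_right]
  nth_rewrite 1 [hs.tsum_eq_zero_add]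
  have h0 : nestedHarmonic (k + 1) 0 = 0 := by simp [nestedHarmonic]
  rw [h0, zero_mul, zero_add, ← hs'.tsum_sub (hs.mul_right z), onesPolylog]
  refine tsum_congr fun n => ?_
  have hn : nestedHarmonic (k + 1) (n + 1)
      = nestedHarmonic (k + 1) n + nestedHarmonic k n / ((n : ℝ) + 1) := by
    simp only [nestedHarmonic, Finset.sum_range_succ]
  rw [hn]
  ring

theorem hasDerivAt_onesPolylog_zero_one {z : ℝ} (hz : |z| < 1) :
    HasDerivAt (onesPolylog 0 1) (1 / (1 - z)) z := by
  refine (hasDerivAt_onesPolylog_one 0 hz).congr_deriv ?_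
  simp [nestedHarmonic, tsum_geometric_of_norm_lt_one (ξ := z) (by simpa using hz)]

theorem hasDerivAt_neg_log_one_sub {z : ℝ} (hz : z < 1) :
    HasDerivAt (fun z => -Real.log (1 - z)) (1 / (1 - z)) z := by
  have h := (((hasDerivAt_id z).const_sub 1).log (by simp; linarith)).neg
  refine h.congr_deriv ?_
  simp [neg_div]

theorem hasDerivAt_neg_log_one_sub_pow (k : ℕ) {z : ℝ} (hz : z < 1) :
    HasDerivAt (fun z => (-Real.log (1 - z)) ^ (k + 1) / ((k + 1).factorial : ℝ))
      ((-Real.log (1 - z)) ^ k / (k.factorial : ℝ) / (1 - z)) z := by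
  have h := ((hasDerivAt_neg_log_one_sub hz).pow (k + 1)).div_const ((k + 1).factorial : ℝ)
  refine h.congr_deriv ?_
  have : (k.factorial : ℝ) ≠ 0 := by exact_mod_cast k.factorial_ne_zero
  have h2 : (1 : ℝ) - z ≠ 0 := by linarith
  rw [Nat.factorial_succ]
  push_cast
  have h3 : (k : ℝ) + 1 ≠ 0 := by positivity
  field_simp

theorem eqOn_of_hasDerivAt_eq {f g h : ℝ → ℝ} (hf : ∀ z, |z| < 1 → HasDerivAt f (h z) z)
    (hg : ∀ z, |z| < 1 → HasDerivAt g (h z) z) (h0 : f 0 = g 0) {z : ℝ} (hz : |z| < 1) :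
    f z = g z := by
  have hmem : ∀ {y : ℝ}, y ∈ Metric.ball (0 : ℝ) 1 ↔ |y| < 1 := by simp
  exact Metric.isOpen_ball.eqOn_of_deriv_eq (convex_ball (0 : ℝ) 1).isPreconnected
    (fun y hy => (hf y (hmem.1 hy)).differentiableAt.differentiableWithinAt)
    (fun y hy => (hg y (hmem.1 hy)).differentiableAt.differentiableWithinAt)
    (fun y hy => (hf y (hmem.1 hy)).deriv.trans (hg y (hmem.1 hy)).deriv.symm)
    (Metric.mem_ball_self one_pos) h0 (hmem.2 hz)

/-- `Li_{1,…,1}(z) = (-log (1 - z)) ^ (k + 1) / (k + 1)!` in depth `k + 1`. -/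
theorem onesPolylog_one_eq (k : ℕ) {z : ℝ} (hz : |z| < 1) :
    onesPolylog k 1 z = (-Real.log (1 - z)) ^ (k + 1) / ((k + 1).factorial : ℝ) := by
  induction k generalizing z with
  | zero =>
    refine eqOn_of_hasDerivAt_eq (f := onesPolylog 0 1) (fun y hy => hasDerivAt_onesPolylog_zero_one hy)
      (g := fun z => (-Real.log (1 - z)) ^ (0 + 1) / ((0 + 1).factorial : ℝ)) (fun y hy => ?_)
      (by simp [onesPolylog_zero_right]) hz
    simpa using hasDerivAt_neg_log_one_sub (abs_lt.1 hy).2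
  | succ k ih =>
    refine eqOn_of_hasDerivAt_eq (f := onesPolylog (k + 1) 1)
      (fun y hy => hasDerivAt_onesPolylog_succ_one k hy)
      (g := fun z => (-Real.log (1 - z)) ^ (k + 1 + 1) / ((k + 1 + 1).factorial : ℝ))
      (fun y hy => ?_) (by simp [onesPolylog_zero_right]) hz
    rw [ih hy]
    exact hasDerivAt_neg_log_one_sub_pow (k + 1) (abs_lt.1 hy).2

theorem summable_onesPolylog_coeff (k s : ℕ) (hs : k + 2 ≤ s) :
    Summable fun n : ℕ => nestedHarmonic k n / ((n : ℝ) + 1) ^ s := by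
  have h : Summable fun n : ℕ => 1 / ((n : ℝ) + 1) ^ 2 := by
    have := (summable_nat_add_iff 1).2 (Real.summable_one_div_nat_pow.2 one_lt_two)
    exact_mod_cast this
  refine Summable.of_nonneg_of_le (onesPolylog_coeff_nonneg k s) (fun n => ?_) h
  rw [div_le_div_iff₀ (by positivity) (by positivity), one_mul]
  calc nestedHarmonic k n * ((n : ℝ) + 1) ^ 2 ≤ ((n : ℝ) + 1) ^ k * ((n : ℝ) + 1) ^ 2 := by
        gcongr
        exact nestedHarmonic_le k n
    _ = ((n : ℝ) + 1) ^ (k + 2) := (pow_add _ _ _).symm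
    _ ≤ ((n : ℝ) + 1) ^ s :=
        pow_le_pow_right₀ (by linarith [(Nat.cast_nonneg n : (0 : ℝ) ≤ n)]) hs

theorem tendsto_onesPolylog_nhdsLT_one (k s : ℕ) (hs : k + 2 ≤ s) :
    Tendsto (onesPolylog k s) (𝓝[<] 1) (𝓝 (onesPolylog k s 1)) := by
  have h : ContinuousOn (onesPolylog k s) (Icc 0 1) := by
    refine continuousOn_tsum (fun n => by fun_prop) (summable_onesPolylog_coeff k s hs)
      fun n z hz => ?_
    rw [norm_mul, Real.norm_of_nonneg (onesPolylog_coeff_nonneg k s n), norm_pow,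
      Real.norm_of_nonneg hz.1]
    exact mul_le_of_le_one_right (onesPolylog_coeff_nonneg k s n) (pow_le_one₀ hz.1 hz.2)
  have h1 := h 1 (right_mem_Icc.2 zero_le_one)
  refine h1.tendsto.mono_left ?_
  rw [← nhdsWithin_Ioo_eq_nhdsLT (zero_lt_one (α := ℝ))]
  exact nhdsWithin_mono _ Ioo_subset_Icc_self

theorem tendsto_log_nhdsLT_one : Tendsto Real.log (𝓝[<] 1) (𝓝 0) := by
  have h := (Real.continuousAt_log one_ne_zero).tendsto
  rw [Real.log_one] at h
  exact h.mono_left nhdsWithin_le_nhds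

theorem tendsto_log_one_sub_mul_log :
    Tendsto (fun z => Real.log (1 - z) * Real.log z) (𝓝[<] 1) (𝓝 0) := by
  have h1 : Tendsto (fun z : ℝ => 1 - z) (𝓝[<] 1) (𝓝[>] 0) := by
    refine tendsto_nhdsWithin_iff.2 ⟨?_, ?_⟩
    · have : Tendsto (fun z : ℝ => 1 - z) (𝓝 1) (𝓝 (1 - 1)) := by
        exact (continuous_const.sub continuous_id).tendsto 1
      rw [sub_self] at this
      exact this.mono_left nhdsWithin_le_nhds
    · filter_upwards [self_mem_nhdsWithin] with z hz
      simpa using hz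
  have h2 : Tendsto (fun z : ℝ => Real.log (1 - z) * (1 - z)) (𝓝[<] 1) (𝓝 0) := by
    have := (tendsto_log_mul_rpow_nhdsGT_zero one_pos).comp h1
    simpa [Function.comp_def] using this
  have h3 : Tendsto (fun z : ℝ => |Real.log (1 - z) * (1 - z)| * z⁻¹) (𝓝[<] 1) (𝓝 0) := by
    have hi : Tendsto (fun z : ℝ => z⁻¹) (𝓝[<] 1) (𝓝 1) := by
      have := (continuousAt_inv₀ (one_ne_zero (α := ℝ))).tendsto
      rw [inv_one] at this
      exact this.mono_left nhdsWithin_le_nhds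
    simpa using h2.abs.mul hi
  refine squeeze_zero_norm' ?_ h3
  filter_upwards [Ioo_mem_nhdsLT (zero_lt_one (α := ℝ))] with z hz
  have hz0 : z ≠ 0 := hz.1.ne'
  rw [Real.norm_eq_abs, abs_mul, abs_mul, mul_assoc]
  gcongr
  rw [abs_of_nonpos (Real.log_nonpos hz.1.le hz.2.le), abs_of_pos (by linarith [hz.2])]
  have := Real.one_sub_inv_le_log_of_pos hz.1
  have h4 : (1 - z) * z⁻¹ = z⁻¹ - 1 := by field_simp
  linarith

/-- The decomposition of `Li_{4,1}(1)`, an integral over the word `x₀³x₁²`, at the point `z`. -/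
noncomputable def splitZetaFourOne (z : ℝ) : ℝ :=
  onesPolylog 1 4 z + onesPolylog 1 3 z * (-Real.log z)
    + onesPolylog 1 2 z * ((-Real.log z) ^ 2 / 2)
    + onesPolylog 1 1 z * ((-Real.log z) ^ 3 / 6)
    + onesPolylog 0 1 z * onesPolylog 2 2 (1 - z) + onesPolylog 2 3 (1 - z)

theorem hasDerivAt_splitZetaFourOne {z : ℝ} (hz : z ∈ Ioo (0 : ℝ) 1) :
    HasDerivAt splitZetaFourOne 0 z := by
  have hz0 : z ≠ 0 := hz.1.ne'
  have hw0 : 1 - z ≠ 0 := by linarith [hz.2]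
  have hzabs : |z| < 1 := abs_lt.2 ⟨by linarith [hz.1], hz.2⟩
  have hwabs : |1 - z| < 1 := abs_lt.2 ⟨by linarith [hz.2], by linarith [hz.1]⟩
  have hl := (Real.hasDerivAt_log hz0).neg
  have hw : HasDerivAt (fun z : ℝ => 1 - z) (-1) z := (hasDerivAt_id z).const_sub 1
  have h211 : HasDerivAt (fun z => onesPolylog 2 2 (1 - z)) _ z :=
    (hasDerivAt_onesPolylog_succ 2 1 hw0 hwabs).comp z hw
  have h311 : HasDerivAt (fun z => onesPolylog 2 3 (1 - z)) _ z :=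
    (hasDerivAt_onesPolylog_succ 2 2 hw0 hwabs).comp z hw
  have h := (((((hasDerivAt_onesPolylog_succ 1 3 hz0 hzabs).add
    ((hasDerivAt_onesPolylog_succ 1 2 hz0 hzabs).mul hl)).add
    ((hasDerivAt_onesPolylog_succ 1 1 hz0 hzabs).mul ((hl.pow 2).div_const 2))).add
    ((hasDerivAt_onesPolylog_succ_one 0 hzabs).mul ((hl.pow 3).div_const 6))).add
    ((hasDerivAt_onesPolylog_zero_one hzabs).mul h211)).add h311
  refine h.congr_deriv ?_
  rw [onesPolylog_one_eq 2 hwabs]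
  simp [Nat.factorial]
  field_simp
  ring

theorem splitZetaFourOne_eq {z : ℝ} (hz : z ∈ Ioo (0 : ℝ) 1) :
    splitZetaFourOne z = splitZetaFourOne (1 / 2) :=
  isOpen_Ioo.eqOn_of_deriv_eq (convex_Ioo (0 : ℝ) 1).isPreconnected
    (fun _ hy => (hasDerivAt_splitZetaFourOne hy).differentiableAt.differentiableWithinAt)
    (differentiableOn_const (splitZetaFourOne (1 / 2)))
    (fun _ hy => by simpa using (hasDerivAt_splitZetaFourOne hy).deriv)
    (show (1 / 2 : ℝ) ∈ Ioo (0 : ℝ) 1 by constructor <;> norm_num) rfl hz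

theorem tendsto_splitZetaFourOne :
    Tendsto splitZetaFourOne (𝓝[<] 1) (𝓝 (onesPolylog 1 4 1)) := by
  have hL := tendsto_log_nhdsLT_one
  have hM := tendsto_log_one_sub_mul_log
  have hmem := Ioo_mem_nhdsLT (zero_lt_one (α := ℝ))
  have habs : ∀ {z : ℝ}, z ∈ Ioo (0 : ℝ) 1 → |z| < 1 ∧ |1 - z| < 1 := fun hz =>
    ⟨abs_lt.2 ⟨by linarith [hz.1], hz.2⟩, abs_lt.2 ⟨by linarith [hz.2], by linarith [hz.1]⟩⟩
  have t2 : Tendsto (fun z => onesPolylog 1 3 z * (-Real.log z)) (𝓝[<] 1) (𝓝 0) := by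
    simpa using (tendsto_onesPolylog_nhdsLT_one 1 3 le_rfl).mul hL.neg
  have t3 : Tendsto (fun z => onesPolylog 1 2 z * ((-Real.log z) ^ 2 / 2)) (𝓝[<] 1) (𝓝 0) := by
    have hb : Tendsto (fun z => (Real.log (1 - z) * Real.log z) ^ 2 / 4) (𝓝[<] 1) (𝓝 0) := by
      simpa using (hM.pow 2).div_const 4
    refine squeeze_zero' ?_ ?_ hb
    · filter_upwards [hmem] with z hz
      have := onesPolylog_nonneg 1 2 hz.1.le
      positivity
    · filter_upwards [hmem] with z hz
      have h := onesPolylog_le_one_weight 1 (s := 2) (by norm_num) hz.1.le hz.2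
      rw [onesPolylog_one_eq 1 (habs hz).1] at h
      calc onesPolylog 1 2 z * ((-Real.log z) ^ 2 / 2)
          ≤ (-Real.log (1 - z)) ^ (1 + 1) / ((1 + 1).factorial : ℝ) * ((-Real.log z) ^ 2 / 2) := by
            gcongr
        _ = (Real.log (1 - z) * Real.log z) ^ 2 / 4 := by
          norm_num [Nat.factorial]
          ring
  have t4 : Tendsto (fun z => onesPolylog 1 1 z * ((-Real.log z) ^ 3 / 6)) (𝓝[<] 1) (𝓝 0) := by
    have hb : Tendsto (fun z => (Real.log (1 - z) * Real.log z) ^ 2 * -Real.log z / 12)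
        (𝓝[<] 1) (𝓝 0) := by
      simpa using ((hM.pow 2).mul hL.neg).div_const 12
    refine hb.congr' ?_
    filter_upwards [hmem] with z hz
    rw [onesPolylog_one_eq 1 (habs hz).1]
    norm_num [Nat.factorial]
    ring
  have t5 : Tendsto (fun z => onesPolylog 0 1 z * onesPolylog 2 2 (1 - z)) (𝓝[<] 1) (𝓝 0) := by
    have hb : Tendsto (fun z => (Real.log (1 - z) * Real.log z) * Real.log z ^ 2 / 6)
        (𝓝[<] 1) (𝓝 0) := by
      simpa using (hM.mul (hL.pow 2)).div_const 6
    refine squeeze_zero' ?_ ?_ hb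
    · filter_upwards [hmem] with z hz
      exact mul_nonneg (onesPolylog_nonneg _ _ hz.1.le)
        (onesPolylog_nonneg _ _ (by linarith [hz.2]))
    · filter_upwards [hmem] with z hz
      have h := onesPolylog_le_one_weight 2 (s := 2) (z := 1 - z) (by norm_num)
        (by linarith [hz.2]) (by linarith [hz.1])
      rw [onesPolylog_one_eq 2 (habs hz).2, sub_sub_cancel] at h
      calc onesPolylog 0 1 z * onesPolylog 2 2 (1 - z) ≤ onesPolylog 0 1 z * _ :=
            mul_le_mul_of_nonneg_left h (onesPolylog_nonneg _ _ hz.1.le)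
        _ = (Real.log (1 - z) * Real.log z) * Real.log z ^ 2 / 6 := by
          rw [onesPolylog_one_eq 0 (habs hz).1]
          norm_num [Nat.factorial]
          ring
  have t6 : Tendsto (fun z => onesPolylog 2 3 (1 - z)) (𝓝[<] 1) (𝓝 0) := by
    have hb : Tendsto (fun z => (-Real.log z) ^ 3 / 6) (𝓝[<] 1) (𝓝 0) := by
      simpa using (hL.neg.pow 3).div_const 6
    refine squeeze_zero' ?_ ?_ hb
    · filter_upwards [hmem] with z hz
      exact onesPolylog_nonneg _ _ (by linarith [hz.2])
    · filter_upwards [hmem] with z hz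
      have h := onesPolylog_le_one_weight 2 (s := 3) (z := 1 - z) (by norm_num)
        (by linarith [hz.2]) (by linarith [hz.1])
      rw [onesPolylog_one_eq 2 (habs hz).2, sub_sub_cancel] at h
      simpa [Nat.factorial] using h
  have h := (((((tendsto_onesPolylog_nhdsLT_one 1 4 (by norm_num)).add t2).add t3).add t4).add t5).add t6
  simp only [add_zero] at h
  exact h

theorem onesPolylog_one_four_one_eq : onesPolylog 1 4 1 = splitZetaFourOne (1 / 2) := by
  refine tendsto_nhds_unique tendsto_splitZetaFourOne (tendsto_const_nhds.congr' ?_)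
  filter_upwards [Ioo_mem_nhdsLT (zero_lt_one (α := ℝ))] with z hz
  exact (splitZetaFourOne_eq hz).symm

/-- Pairs `n₁ > n₂ ≥ 1`, enumerated by `n₁ - 1` and then `n₂ - 1`. -/
def decreasingIndexTwoEquiv : (Σ n : ℕ, Fin n) ≃ DecreasingIndex 2 where
  toFun p := ⟨![p.1 + 1, p.2 + 1], by
    refine ⟨Fin.strictAnti_iff_succ_lt.2 fun i => ?_, fun i => ?_⟩
    · fin_cases i
      simp
    · fin_cases i <;> simp⟩
  invFun n := ⟨n.1 0 - 1, ⟨n.1 1 - 1, by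
    have := n.2.1 (show (0 : Fin 2) < 1 by decide)
    have := n.2.2 1
    omega⟩⟩
  left_inv p := by simp
  right_inv n := by
    refine Subtype.ext (funext fun i => ?_)
    have h0 := n.2.2 0
    have h1 := n.2.2 1
    fin_cases i
    · simpa using Nat.sub_add_cancel h0
    · simpa using Nat.sub_add_cancel h1

/-- Triples `n₁ > n₂ > n₃ ≥ 1`, enumerated by `n₁ - 1`, `n₂ - 1` and then `n₃ - 1`. -/
def decreasingIndexThreeEquiv : (Σ n : ℕ, Σ m : Fin n, Fin m) ≃ DecreasingIndex 3 where
  toFun p := ⟨![p.1 + 1, p.2.1 + 1, p.2.2 + 1], by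
    refine ⟨Fin.strictAnti_iff_succ_lt.2 fun i => ?_, fun i => ?_⟩
    · fin_cases i <;> simp
    · fin_cases i <;> simp⟩
  invFun n := ⟨n.1 0 - 1, ⟨n.1 1 - 1, by
    have := n.2.1 (show (0 : Fin 3) < 1 by decide)
    have := n.2.2 1
    omega⟩, ⟨n.1 2 - 1, by
    have := n.2.1 (show (1 : Fin 3) < 2 by decide)
    have := n.2.2 2
    simp only
    omega⟩⟩
  left_inv p := by simp
  right_inv n := by
    refine Subtype.ext (funext fun i => ?_)
    have h0 := n.2.2 0
    have h1 := n.2.2 1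
    have h2 := n.2.2 2
    fin_cases i
    · simpa using Nat.sub_add_cancel h0
    · simpa using Nat.sub_add_cancel h1
    · simpa using Nat.sub_add_cancel h2

theorem decreasingIndexTwoEquiv_apply (p : Σ n : ℕ, Fin n) :
    (decreasingIndexTwoEquiv p).1 = ![p.1 + 1, (p.2 : ℕ) + 1] := rfl

theorem decreasingIndexThreeEquiv_apply (p : Σ n : ℕ, Σ m : Fin n, Fin m) :
    (decreasingIndexThreeEquiv p).1 = ![p.1 + 1, (p.2.1 : ℕ) + 1, (p.2.2 : ℕ) + 1] := rfl

theorem hasSum_sigma_fintype_of_nonneg {α : ℕ → Type*} [∀ n, Fintype (α n)]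
    {f : (Σ n, α n) → ℝ} (hf : ∀ p, 0 ≤ f p) {g : ℕ → ℝ} (hg : ∀ n, ∑ a, f ⟨n, a⟩ = g n)
    (hs : Summable g) : HasSum f (∑' n, g n) := by
  have hsum : Summable f := by
    refine (summable_sigma_of_nonneg hf).2 ⟨fun n => (hasSum_fintype _).summable, ?_⟩
    simpa [tsum_fintype, hg] using hs
  have h := hsum.tsum_sigma
  simp only [tsum_fintype, hg] at h
  exact h ▸ hsum.hasSum

theorem hasSum_multiPolylogTerm_two (s : ℕ) {z : ℝ} (hz : 0 ≤ z)
    (hs : Summable fun n : ℕ => nestedHarmonic 1 n / ((n : ℝ) + 1) ^ s * z ^ (n + 1)) :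
    HasSum (multiPolylogTerm ![s, 1] (singleArg 1 z)) (onesPolylog 1 s z) := by
  rw [← decreasingIndexTwoEquiv.hasSum_iff]
  refine hasSum_sigma_fintype_of_nonneg (fun p => ?_) (fun n => ?_) hs
  · simp [decreasingIndexTwoEquiv_apply, multiPolylogTerm, singleArg, Fin.prod_univ_succ]
    positivity
  · simp [decreasingIndexTwoEquiv_apply, multiPolylogTerm, singleArg, Fin.prod_univ_succ,
      nestedHarmonic, ← Fin.sum_univ_eq_sum_range, Finset.sum_div, Finset.sum_mul]
    refine Finset.sum_congr rfl fun i _ => ?_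
    field_simp

theorem hasSum_multiPolylogTerm_three (s : ℕ) {z : ℝ} (hz : 0 ≤ z)
    (hs : Summable fun n : ℕ => nestedHarmonic 2 n / ((n : ℝ) + 1) ^ s * z ^ (n + 1)) :
    HasSum (multiPolylogTerm ![s, 1, 1] (singleArg 2 z)) (onesPolylog 2 s z) := by
  rw [← decreasingIndexThreeEquiv.hasSum_iff]
  refine hasSum_sigma_fintype_of_nonneg (fun p => ?_) (fun n => ?_) hs
  · simp [decreasingIndexThreeEquiv_apply, multiPolylogTerm, singleArg, Fin.prod_univ_succ]
    positivity
  · rw [Fintype.sum_sigma]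
    simp [decreasingIndexThreeEquiv_apply, multiPolylogTerm, singleArg, Fin.prod_univ_succ,
      nestedHarmonic, Finset.sum_range, Finset.sum_div, Finset.sum_mul]
    refine Finset.sum_congr rfl fun i _ => Finset.sum_congr rfl fun j _ => ?_
    field_simp

theorem hasSum_delta_two (s : ℕ) :
    HasSum (multiPolylogTerm ![s, 1] (singleArg 1 (1 / 2))) (onesPolylog 1 s (1 / 2)) :=
  hasSum_multiPolylogTerm_two s (by norm_num)
    (summable_onesPolylog 1 s (by rw [abs_of_pos] <;> norm_num))

theorem hasSum_delta_three (s : ℕ) :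
    HasSum (multiPolylogTerm ![s, 1, 1] (singleArg 2 (1 / 2))) (onesPolylog 2 s (1 / 2)) :=
  hasSum_multiPolylogTerm_three s (by norm_num)
    (summable_onesPolylog 2 s (by rw [abs_of_pos] <;> norm_num))

theorem hasSum_multiZetaTerm_four_one :
    HasSum (multiZetaTerm ![4, 1]) (onesPolylog 1 4 1) := by
  have h := hasSum_multiPolylogTerm_two 4 zero_le_one
    (by simpa using summable_onesPolylog_coeff 1 4 (by norm_num))
  convert h using 1
  funext n
  simp [multiPolylogTerm, multiZetaTerm, singleArg, Fin.prod_univ_succ]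

theorem mainTheorem1 :
    (Summable (multiZetaTerm ![4, 1]) ∧
      DeltaConverges ![4, 1] ∧ DeltaConverges ![3, 1] ∧ DeltaConverges ![2, 1] ∧
      DeltaConverges ![3, 1, 1] ∧ DeltaConverges ![2, 1, 1]) ∧
    multiZeta ![4, 1] =
      deltaValue ![4, 1] + deltaValue ![3, 1] * Real.log 2
        + (1 / 2) * deltaValue ![2, 1] * (Real.log 2) ^ 2
        + deltaValue ![3, 1, 1] + deltaValue ![2, 1, 1] * Real.log 2
        + (1 / 12) * (Real.log 2) ^ 5 := by
  refine ⟨⟨hasSum_multiZetaTerm_four_one.summable, (hasSum_delta_two 4).summable,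
    (hasSum_delta_two 3).summable, (hasSum_delta_two 2).summable,
    (hasSum_delta_three 3).summable, (hasSum_delta_three 2).summable⟩, ?_⟩
  have hz : multiZeta ![4, 1] = onesPolylog 1 4 1 := hasSum_multiZetaTerm_four_one.tsum_eq
  have h2 (s : ℕ) : deltaValue ![s, 1] = onesPolylog 1 s (1 / 2) := (hasSum_delta_two s).tsum_eq
  have h3 (s : ℕ) : deltaValue ![s, 1, 1] = onesPolylog 2 s (1 / 2) :=
    (hasSum_delta_three s).tsum_eq
  have habs : |(1 / 2 : ℝ)| < 1 := by rw [abs_of_pos] <;> norm_num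
  have hhalf : (1 : ℝ) - 1 / 2 = 1 / 2 := by norm_num
  have hlog : -Real.log (1 / 2) = Real.log 2 := by rw [one_div, Real.log_inv, neg_neg]
  rw [hz, h2, h2, h2, h3, h3, onesPolylog_one_four_one_eq, splitZetaFourOne,
    onesPolylog_one_eq 1 habs, onesPolylog_one_eq 0 habs, hhalf, hlog]
  norm_num [Nat.factorial]
  ring
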